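/- Let $\pi\colon E\to M$ be a smooth bundle (a surjective submersion suffices), where $M$ is an $m$-dimensional manifold with a volume form $\eta$ and $\dim E=m+n$. Let $J^k\pi$ be the $k$-th jet bundle, with coordinates $(x^i,u^\alpha_I)_{0\le|I|\le k}$ induced by coordinates $(x^i,u^\alpha)$ of $E$ adapted to $\pi$, and let $L\in C^\infty(J^2\pi)$, with Lagrangian density $\mathcal L=L\,\eta$; in adapted coordinates write $\mathcal L=L\,d^mx$, with the same letter for the local Lagrangian function. Put $n(ii)=1$ and $n(ij)=2$ for $i\ne j$. Let $J^2\pi^\dagger$ be the bundle over $J^1\pi$ of the $m$-forms on $J^1\pi$ that vanish on any two vectors vertical over $M$ and are symmetric in their second-order momenta, that is, the forms $$p\,d^mx+p^i_\alpha\,du^\alpha\wedge d^{m-1}x_i+\tfrac1{n(ij)}\,p^{1_i+1_j}_\alpha\,du^\alpha_i\wedge d^{m-1}x_j ,$$ with coordinates $(x^i,u^\alpha,u^\alpha_i,p,p^i_\alpha,p^I_\alpha)$, $|I|=2$. Let $\Theta_1^s$ be its tautological $m$-form (given by the same expression), let $\Omega_1^s=-d\Theta_1^s$, and let $J^2\pi^\ddagger$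 be the quotient of $J^2\pi^\dagger$ by the forms semibasic over $M$. Put $\mathcal W=J^3\pi\times_{J^1\pi}J^2\pi^\dagger$ and $\mathcal W_r=J^3\pi\times_{J^1\pi}J^2\pi^\ddagger$, with projections $\rho_2\colon\mathcal W\to J^2\pi^\dagger$ and $\rho_1^r\colon\mathcal W_r\to J^3\pi$. Let $\hat h\colon\mathcal W_r\to\mathcal W$ be the section given locally by $p=-\hat H$, where $\hat H=p^i_\alpha u^\alpha_i+p^I_\alpha u^\alpha_I-L$ (sum over $|I|=2$), and let $\Omega_r=\hat h^*\rho_2^*\Omega_1^s$. Let $\widetilde{\mathcal{FL}}\colon J^3\pi\to J^2\pi^\dagger$ be the extended Legendre map over $J^1\pi$, given locally by $$p^i_\alpha=\frac{\partial L}{\partial u^\alpha_i}-\sum_{j}\frac1{n(ij)}\frac{d}{dx^j}\frac{\partial L}{\partial u^\alpha_{1_i+1_j}},\qquad p^I_\alpha=\frac{\partial L}{\partial u^\alpha_I},\qquad p=L-p^i_\alpha u^\alpha_i-p^I_\alpha u^\alpha_I ,$$ where $d/dx^j$ is the total derivative, and let $\Omega_{\mathcal L}=\widetilde{\mathcal{FL}}{}^*\Omega_1^s$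 be the Poincaré–Cartan $(m+1)$-form on $J^3\pi$. A section of $J^3\pi\to M$ is holonomic if it is $j^3\phi$ for a section $\phi$ of $\pi$, and a section $\psi$ of $\mathcal W_r\to M$ is holonomic if $\rho_1^r\circ\psi$ is. **Proposition.** Let $\psi$ be a smooth holonomic section of $\mathcal W_r\to M$, defined over an open set $U\subseteq M$ (for example $U=M$), such that $\psi^*\,i(X)\Omega_r=0$ for every vector field $X$ on $\mathcal W_r$. Then $\psi_{\mathcal L}=\rho_1^r\circ\psi$ is a smooth holonomic section of $J^3\pi\to M$ over $U$, and $\psi_{\mathcal L}^*\,i(X)\Omega_{\mathcal L}=0$ for every vector field $X$ on $J^3\pi$. -/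

import Mathlib

open scoped Manifold ContDiff Topology

noncomputable section

namespace SecondOrderField

/-! ### Multi-indices, partial derivatives and coordinate spaces -/

/-- Model space of the base manifold; coordinates `x^i`. -/
abbrev Base (m : ℕ) := Fin m → ℝ

/-- Model space of the fibres of the bundle; coordinates `u^α`. -/
abbrev Fibre (n : ℕ) := Fin n → ℝ

/-- Multi-indices `I` with `|I| ≤ k`. -/
abbrev MIdx (m k : ℕ) := {I : Fin m → ℕ // ∑ i, I i ≤ k}

instance (m k : ℕ) : Fintype (MIdx m k) :=
  Fintype.ofInjective
    (fun I : MIdx m k => fun i : Fin m =>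
      (⟨I.1 i, Nat.lt_succ_of_le
        ((Finset.single_le_sum (fun _ _ => Nat.zero_le _) (Finset.mem_univ i)).trans I.2)⟩ :
        Fin (k + 1)))
    (fun I J h => Subtype.ext (funext fun i => by simpa using congrArg Fin.val (congrFun h i)))

/-- Multi-indices `I` with `|I| = 2`. -/
abbrev MIdxTwo (m : ℕ) := {I : MIdx m 2 // ∑ i, I.1 i = 2}

namespace MIdx

variable {m : ℕ}

/-- The multi-index `0`. -/
def zero (k : ℕ) : MIdx m k := ⟨0, by simp⟩

/-- The multi-index `1_i`, among the multi-indices of length at most `k + 1`. -/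
def one (k : ℕ) (i : Fin m) : MIdx m (k + 1) := ⟨Pi.single i 1, by simp⟩

/-- The multi-index `I + 1_i`. -/
def succ {k : ℕ} (I : MIdx m k) (i : Fin m) : MIdx m (k + 1) :=
  ⟨I.1 + Pi.single i 1, by simpa [Finset.sum_add_distrib] using I.2⟩

/-- The multi-index `1_i + 1_j`. -/
def two (i j : Fin m) : MIdxTwo m :=
  ⟨succ (one 0 i) j, by simp [succ, one, Finset.sum_add_distrib]⟩

end MIdx

/-- `n(ij)`, equal to `1` if `i = j` and to `2` if `i ≠ j`. -/
def nn {m : ℕ} (i j : Fin m) : ℝ := if i = j then 1 else 2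

/-- The partial derivative `∂s/∂x^i`. -/
def pderiv {m n : ℕ} (i : Fin m) (s : Base m → Fibre n) : Base m → Fibre n :=
  fun x => fderiv ℝ s x (Pi.single i 1)

/-- The partial derivative `∂^{|I|} s/∂x^I`. -/
def partialDeriv {m n : ℕ} (I : Fin m → ℕ) (s : Base m → Fibre n) : Base m → Fibre n :=
  ((List.finRange m).flatMap fun i => List.replicate (I i) i).foldr pderiv s

/-- Coordinates `(x^i, u^α_I)`, `0 ≤ |I| ≤ k`, on the `k`-th jet bundle (with `u^α_0 = u^α`). -/
abbrev JetModel (m n k : ℕ) := Base m × (MIdx m k → Fibre n)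

/-- The projection forgetting the coordinates `u^α_I` with `|I| > l`. -/
def truncate {m n k l : ℕ} (h : l ≤ k) (q : JetModel m n k) : JetModel m n l :=
  (q.1, fun I => q.2 ⟨I.1, I.2.trans h⟩)

/-- The `k`-th holonomic lift of `v` at the `(k+1)`-jet with coordinates `q`:
`v^i (∂/∂x^i + u^α_{I+1_i} ∂/∂u^α_I)`. -/
def holonomicLift {m n k : ℕ} (q : JetModel m n (k + 1)) (v : Base m) : JetModel m n k :=
  (v, fun I => ∑ i, v i • q.2 (I.succ i))

/-! ### Fibred manifolds, adapted charts and jets -/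

/-- A configuration bundle `π : E → M`, with `dim M = m` and `dim E = m + n`. -/
structure ConfigBundle (m n : ℕ) (M E : Type*)
    [TopologicalSpace M] [ChartedSpace (Base m) M]
    [TopologicalSpace E] [ChartedSpace (Base m × Fibre n) E] where
  proj : E → M
  surjective : Function.Surjective proj
  submersion : Manifold.IsSubmersion 𝓘(ℝ, Base m × Fibre n) 𝓘(ℝ, Base m) ∞ proj

section Jets

variable {m n : ℕ} {M E : Type*}
  [TopologicalSpace M] [ChartedSpace (Base m) M]
  [TopologicalSpace E] [ChartedSpace (Base m × Fibre n) E]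

/-- Local coordinates `(x^i, u^α)` of `E` adapted to the bundle structure: a chart `tot` of `E` and
a chart `base` of `M` such that `π` is `(x, u) ↦ x`. -/
structure AdaptedChart (B : ConfigBundle m n M E) where
  tot : OpenPartialHomeomorph E (Base m × Fibre n)
  base : OpenPartialHomeomorph M (Base m)
  tot_mem : tot ∈ IsManifold.maximalAtlas 𝓘(ℝ, Base m × Fibre n) ∞ E
  base_mem : base ∈ IsManifold.maximalAtlas 𝓘(ℝ, Base m) ∞ M
  proj_mem : ∀ e ∈ tot.source, B.proj e ∈ base.source
  proj_eq : ∀ e ∈ tot.source, base (B.proj e) = (tot e).1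

/-- A smooth local section of `π` defined around `x` (given by a map whose values matter only
near `x`). -/
def IsSectionNear (B : ConfigBundle m n M E) (x : M) (φ : M → E) : Prop :=
  ∀ᶠ y in 𝓝 x, B.proj (φ y) = y ∧
    ContMDiffAt 𝓘(ℝ, Base m) 𝓘(ℝ, Base m × Fibre n) ∞ φ y

/-- Local sections of `π` around `x`. -/
def SectionNear (B : ConfigBundle m n M E) (x : M) := {φ : M → E // IsSectionNear B x φ}

namespace AdaptedChart

variable {B : ConfigBundle m n M E}

/-- The components `φ^α(x^i)` of a section in an adapted chart. -/
def sectionRep (c : AdaptedChart B) (φ : M → E) : Base m → Fibre n :=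
  fun y => (c.tot (φ (c.base.symm y))).2

end AdaptedChart

/-- Equality of `k`-jets at `x`: equality at `x` of the values and of all the partial derivatives
up to order `k` in adapted coordinates. -/
def jetSetoid (B : ConfigBundle m n M E) (k : ℕ) (x : M) : Setoid (SectionNear B x) where
  r φ φ' := φ.1 x = φ'.1 x ∧ ∀ c : AdaptedChart B, φ.1 x ∈ c.tot.source → ∀ I : MIdx m k,
    partialDeriv I.1 (c.sectionRep φ.1) (c.base x) =
      partialDeriv I.1 (c.sectionRep φ'.1) (c.base x)
  iseqv :=
    { refl := fun _ => ⟨rfl, fun _ _ _ => rfl⟩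
      symm := fun h => ⟨h.1.symm, fun c hc I => (h.2 c (h.1 ▸ hc) I).symm⟩
      trans := fun h h' => ⟨h.1.trans h'.1, fun c hc I =>
        (h.2 c hc I).trans (h'.2 c (h.1 ▸ hc) I)⟩ }

/-- The `k`-th jet bundle `J^kπ`: pairs of a point `x` and a `k`-jet at `x` of a local section. -/
def Jet (B : ConfigBundle m n M E) (k : ℕ) := Σ x : M, Quotient (jetSetoid B k x)

namespace Jet

variable {B : ConfigBundle m n M E} {k l : ℕ}

/-- The `k`-jet `j^k_x φ`. -/
def mk (k : ℕ) (x : M) (φ : M → E) (h : IsSectionNear B x φ) : Jet B k :=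
  ⟨x, Quotient.mk (jetSetoid B k x) ⟨φ, h⟩⟩

/-- The projection `J^kπ → M`. -/
def point (j : Jet B k) : M := j.1

/-- A local section representing a jet. -/
def rep (j : Jet B k) : SectionNear B j.1 := j.2.out

/-- The projection `J^kπ → E`, `j^k_x φ ↦ φ(x)`. -/
def value (j : Jet B k) : E := j.rep.1 j.1

/-- The projection `J^kπ → J^lπ`, `j^k_x φ ↦ j^l_x φ`. -/
def proj (_h : l ≤ k) (j : Jet B k) : Jet B l := mk l j.1 j.rep.1 j.rep.2

theorem value_mk (x : M) (φ : M → E) (h : IsSectionNear B x φ) : (mk k x φ h).value = φ x :=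
  (Quotient.mk_out (s := jetSetoid B k x) ⟨φ, h⟩).1

end Jet

namespace AdaptedChart

variable {B : ConfigBundle m n M E} {k : ℕ}

/-- The domain in `J^kπ` of the coordinates induced by an adapted chart. -/
def jetSource (c : AdaptedChart B) (k : ℕ) : Set (Jet B k) := {j | j.value ∈ c.tot.source}

/-- The image of the coordinates induced on `J^kπ`. -/
def jetTarget (c : AdaptedChart B) (k : ℕ) : Set (JetModel m n k) :=
  {q | (q.1, q.2 (MIdx.zero k)) ∈ c.tot.target}

/-- The induced coordinates `(x^i, u^α_I)` of a jet: `u^α_I = ∂^{|I|} φ^α/∂x^I`. -/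
def jetCoord (c : AdaptedChart B) (j : Jet B k) : JetModel m n k :=
  (c.base j.1, fun I => partialDeriv I.1 (c.sectionRep j.rep.1) (c.base j.1))

theorem jetCoord_mk (c : AdaptedChart B) (x : M) (φ : M → E) (h : IsSectionNear B x φ)
    (hx : φ x ∈ c.tot.source) :
    c.jetCoord (Jet.mk k x φ h) =
      (c.base x, fun I : MIdx m k => partialDeriv I.1 (c.sectionRep φ) (c.base x)) := by
  have hv : (Jet.mk k x φ h).rep.1 x = φ x := Jet.value_mk x φ h
  exact Prod.ext rfl (funext fun I =>
    (Quotient.mk_out (s := jetSetoid B k x) ⟨φ, h⟩).2 c (hv ▸ hx) I)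

open Classical in
/-- The expression in induced coordinates of a map defined on `J^kπ`: its value at `q` is the value
of the map at the jet with coordinates `q` (and `0` outside the image of the coordinates). -/
def jetRep (c : AdaptedChart B) {V : Type*} [Zero V] (F : Jet B k → V) : JetModel m n k → V :=
  fun q => if h : ∃ j ∈ c.jetSource k, c.jetCoord j = q then F h.choose else 0

/-- The change of coordinates in `J^kπ`, from `c` to `c'`. -/
def jetTransition (c c' : AdaptedChart B) (k : ℕ) : JetModel m n k → JetModel m n k :=
  c.jetRep c'.jetCoord

end AdaptedChart

/-! ### Volume forms and Lagrangians -/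

/-- The coefficient of `dx^1 ∧ ⋯ ∧ dx^m` of an `m`-form on `M` in a chart of `M`. -/
def formDensity (η : ∀ x : M, TangentSpace 𝓘(ℝ, Base m) x [⋀^Fin m]→L[ℝ] ℝ)
    (b : OpenPartialHomeomorph M (Base m)) (y : Base m) : ℝ :=
  η (b.symm y) fun i =>
    mfderiv 𝓘(ℝ, Base m) 𝓘(ℝ, Base m) b.symm y (Pi.single i 1 : Base m)

/-- A smooth volume form on `M`. -/
structure VolumeForm (m : ℕ) (M : Type*) [TopologicalSpace M] [ChartedSpace (Base m) M] where
  form : ∀ x : M, TangentSpace 𝓘(ℝ, Base m) x [⋀^Fin m]→L[ℝ] ℝ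
  ne_zero : ∀ x, form x ≠ 0
  smooth : ∀ b ∈ IsManifold.maximalAtlas 𝓘(ℝ, Base m) ∞ M,
    ContDiffOn ℝ ∞ (formDensity form b) b.target

/-- Smoothness of a real function on `J^kπ`. -/
def IsSmoothOnJets {B : ConfigBundle m n M E} {k : ℕ} (F : Jet B k → ℝ) : Prop :=
  ∀ c : AdaptedChart B, ContDiffOn ℝ ∞ (c.jetRep F) (c.jetTarget k)

/-- The local expression of the Lagrangian density `ℒ = L · η`: the function `L_c` such that
`ℒ = L_c d^m x` in the coordinates of `c`. It is the expression of `L` itself if `η = d^m x`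
in `c`. -/
def AdaptedChart.lagrangian {B : ConfigBundle m n M E} (c : AdaptedChart B) (η : VolumeForm m M)
    (L : Jet B 2 → ℝ) : JetModel m n 2 → ℝ :=
  fun q => formDensity η.form c.base q.1 * c.jetRep L q

end Jets

/-! ### Forms in coordinates -/

section Forms

/-- The pull-back `f^*ζ` of a differential form. -/
def pullback {V W : Type*} [NormedAddCommGroup V] [NormedSpace ℝ V] [NormedAddCommGroup W]
    [NormedSpace ℝ W] {r : ℕ} (f : V → W) (ζ : W → W [⋀^Fin r]→L[ℝ] ℝ) :
    V → V [⋀^Fin r]→L[ℝ] ℝ :=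
  fun x => (ζ (f x)).compContinuousLinearMap (fderiv ℝ f x)

/-- The contraction `i(X)Ω` of a differential form with a vector field. -/
def contract {V : Type*} [NormedAddCommGroup V] [NormedSpace ℝ V] {r : ℕ} (X : V → V)
    (Ω : V → V [⋀^Fin (r + 1)]→L[ℝ] ℝ) : V → V [⋀^Fin r]→L[ℝ] ℝ :=
  fun x => (Ω x).curryLeft (X x)

/-- The exterior product `ℓ_1 ∧ ⋯ ∧ ℓ_m`, that is, `(v_1, …, v_m) ↦ det (ℓ_a (v_b))`. -/
def wedge {V : Type*} [NormedAddCommGroup V] [NormedSpace ℝ V] {m : ℕ}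
    (ℓ : Fin m → V →L[ℝ] ℝ) : V [⋀^Fin m]→L[ℝ] ℝ :=
  { (Matrix.detRowAlternating (n := Fin m) (R := ℝ)).compLinearMap
      (LinearMap.pi fun a => (ℓ a).toLinearMap) with
    cont := by
      change Continuous fun v : Fin m → V => Matrix.det (Matrix.of fun b a => ℓ a (v b))
      refine Continuous.matrix_det ?_
      exact continuous_pi fun b => continuous_pi fun a => (ℓ a).continuous.comp (continuous_apply b) }

theorem wedge_apply {V : Type*} [NormedAddCommGroup V] [NormedSpace ℝ V] {m : ℕ}
    (ℓ : Fin m → V →L[ℝ] ℝ) (v : Fin m → V) :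
    wedge ℓ v = Matrix.det (Matrix.of fun b a => ℓ a (v b)) := rfl

variable {m n : ℕ}

/-- `dx^i` on the coordinate space of `J^kπ`. -/
def dx {k : ℕ} (i : Fin m) : JetModel m n k →L[ℝ] ℝ :=
  (ContinuousLinearMap.proj i).comp (ContinuousLinearMap.fst ℝ _ _)

/-- `du^α_I` on the coordinate space of `J^kπ`. -/
def du {k : ℕ} (I : MIdx m k) (α : Fin n) : JetModel m n k →L[ℝ] ℝ :=
  ((ContinuousLinearMap.proj α).comp (ContinuousLinearMap.proj I)).comp
    (ContinuousLinearMap.snd ℝ (Base m) (MIdx m k → Fibre n))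

/-- The coordinate vector `∂/∂x^i`. -/
def vecx {k : ℕ} (i : Fin m) : JetModel m n k := (Pi.single i 1, 0)

/-- The coordinate vector `∂/∂u^α_I`. -/
def vecu {k : ℕ} (I : MIdx m k) (α : Fin n) : JetModel m n k :=
  (0, Pi.single I (Pi.single α 1))

/-- The partial derivative `∂F/∂u^α_I`. -/
def pderivU {k : ℕ} (F : JetModel m n k → ℝ) (I : MIdx m k) (α : Fin n) (q : JetModel m n k) : ℝ :=
  fderiv ℝ F q (vecu I α)

/-- The coordinate total derivative `dF/dx^i`. -/
def totalDeriv {k : ℕ} (i : Fin m) (F : JetModel m n k → ℝ) (q : JetModel m n (k + 1)) : ℝ :=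
  fderiv ℝ F (truncate (Nat.le_succ k) q) (holonomicLift q (Pi.single i 1))

/-- Momentum coordinates `(p^i_α, p^I_α)`, `|I| = 2`. -/
abbrev RMom (m n : ℕ) := (Fin m → Fibre n) × (MIdxTwo m → Fibre n)

/-- Momentum coordinates `(p, p^i_α, p^I_α)`, `|I| = 2`. -/
abbrev XMom (m n : ℕ) := ℝ × RMom m n

/-- The 2-symmetric `m`-form with coordinates `(p, p^i_α, p^I_α)`:
`p d^mx + p^i_α du^α ∧ d^{m-1}x_i + (1/n(ij)) p^{1_i+1_j}_α du^α_i ∧ d^{m-1}x_j`.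
Note that `β ∧ d^{m-1}x_j` is `d^mx = dx^1 ∧ ⋯ ∧ dx^m` with the factor `dx^j` replaced by `β`. -/
def momentumForm (P : XMom m n) : JetModel m n 1 [⋀^Fin m]→L[ℝ] ℝ :=
  P.1 • wedge dx
    + ∑ i, ∑ α, P.2.1 i α • wedge (Function.update dx i (du (MIdx.zero 1) α))
    + ∑ i, ∑ j, ∑ α, (1 / nn i j * P.2.2 (MIdx.two i j) α) •
        wedge (Function.update dx j (du (MIdx.one 0 i) α))

/-- Coordinates of the extended 2-symmetric multimomentum bundle. -/
abbrev DagModel (m n : ℕ) := JetModel m n 1 × XMom m n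

/-- Coordinates of `𝒲 = J^3π ×_{J^1π} J^2π^†`. -/
abbrev WModel (m n : ℕ) := JetModel m n 3 × XMom m n

/-- Coordinates of `𝒲_r = J^3π ×_{J^1π} J^2π^‡`. -/
abbrev WrModel (m n : ℕ) := JetModel m n 3 × RMom m n

/-- The symmetrized Liouville `m`-form `Θ_1^s`, that is, the tautological form
`Θ_1^s(ζ)(X_1, …, X_m) = ζ(Tπ X_1, …, Tπ X_m)`. -/
def liouville (z : DagModel m n) : DagModel m n [⋀^Fin m]→L[ℝ] ℝ :=
  (momentumForm z.2).compContinuousLinearMap (ContinuousLinearMap.fst ℝ _ _)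

/-- The symmetrized Liouville `(m+1)`-form `Ω_1^s = -dΘ_1^s`. -/
def liouvilleOmega (z : DagModel m n) : DagModel m n [⋀^Fin (m + 1)]→L[ℝ] ℝ :=
  -extDeriv liouville z

/-- The projection `ρ_2 : 𝒲 → J^2π^†`. -/
def rhoTwo (w : WModel m n) : DagModel m n := (truncate (by norm_num) w.1, w.2)

/-- The unified canonical form `Ω = ρ_2^* Ω_1^s` on `𝒲`. -/
def unifiedOmega : WModel m n → WModel m n [⋀^Fin (m + 1)]→L[ℝ] ℝ :=
  pullback rhoTwo liouvilleOmega

/-- The coupling function `Ĉ`, with `Ĉ(j^3_xφ, ζ) d^mx = (j^1φ)^* ζ`. -/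
def coupling (w : WModel m n) : ℝ :=
  momentumForm w.2 fun i =>
    holonomicLift (k := 1) (truncate (by norm_num) w.1) (Pi.single i 1)

/-- The local Hamiltonian function `Ĥ = p^i_α u^α_i + p^I_α u^α_I - L̂`. -/
def hamiltonian (L : JetModel m n 2 → ℝ) (w : WrModel m n) : ℝ :=
  (∑ i, ∑ α, w.2.1 i α * w.1.2 (MIdx.one 2 i) α)
    + (∑ I : MIdxTwo m, ∑ α, w.2.2 I α * w.1.2 ⟨I.1.1, I.1.2.trans (by norm_num)⟩ α)
    - L (truncate (by norm_num) w.1)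

/-- The Hamiltonian section `ĥ : 𝒲_r → 𝒲`, given by `p = -Ĥ`. -/
def hamiltonSection (L : JetModel m n 2 → ℝ) (w : WrModel m n) : WModel m n :=
  (w.1, -hamiltonian L w, w.2)

theorem wedge_update (j : Fin m) {k : ℕ} (β : JetModel m n k →L[ℝ] ℝ)
    (v : Fin m → JetModel m n k) (hv : ∀ i, (v i).1 = Pi.single i 1) :
    wedge (Function.update dx j β) v = β (v j) := by
  have h : (Matrix.of fun b a : Fin m => (Function.update dx j β a) (v b))
      = (1 : Matrix (Fin m) (Fin m) ℝ).updateCol j fun b => β (v b) := by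
    ext b a
    by_cases h : a = j
    · subst h; simp
    · simp [h, dx, hv, Pi.single_apply, Matrix.one_apply, eq_comm]
  rw [wedge_apply, h, ← Matrix.cramer_apply, Matrix.cramer_one]; rfl

theorem wedge_dx {k : ℕ} (v : Fin m → JetModel m n k) (hv : ∀ i, (v i).1 = Pi.single i 1) :
    wedge dx v = 1 := by
  rw [wedge_apply, ← Matrix.det_one (n := Fin m) (R := ℝ)]
  congr 1; ext b a
  simp [dx, hv, Pi.single_apply, Matrix.one_apply, eq_comm]

theorem holonomicLift_single {k : ℕ} (q : JetModel m n (k+1)) (j : Fin m) (I : MIdx m k) :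
    (holonomicLift q (Pi.single j 1)).2 I = q.2 (I.succ j) := by
  simp [holonomicLift, Pi.single_apply]

theorem exists_two (I : MIdxTwo m) : ∃ i j, MIdx.two i j = I := by
  obtain ⟨⟨I, h2⟩, h⟩ := I
  simp only at h
  have h0 : ∃ i, I i ≠ 0 := by
    by_contra hc; push Not at hc; simp [hc] at h
  obtain ⟨i, hi⟩ := h0
  have hs : I = (I - Pi.single i 1) + Pi.single i 1 := by
    ext a; by_cases ha : a = i
    · subst ha; simp; omega
    · simp [ha]
  have h1 : ∑ a, (I - Pi.single i 1 : Fin m → ℕ) a = 1 := by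
    have := congrArg (fun J : Fin m → ℕ => ∑ a, J a) hs
    simp only [Pi.add_apply, Finset.sum_add_distrib, h, Finset.sum_pi_single', Finset.mem_univ, if_true] at this
    omega
  generalize (I - Pi.single i 1 : Fin m → ℕ) = J at hs h1
  have h0 : ∃ j, J j ≠ 0 := by
    by_contra hc; push Not at hc; simp [hc] at h1
  obtain ⟨j, hj⟩ := h0
  have hJ : J = Pi.single j 1 := by
    have hle : ∀ a, a ≠ j → J a = 0 := by
      intro a ha
      have := Finset.add_le_sum (f := J) (s := Finset.univ) (fun _ _ => Nat.zero_le _)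
        (Finset.mem_univ a) (Finset.mem_univ j) ha
      omega
    have hj1 : J j = 1 := by
      have := Finset.single_le_sum (f := J) (s := Finset.univ) (fun _ _ => Nat.zero_le _)
        (Finset.mem_univ j)
      omega
    ext a; by_cases ha : a = j
    · subst ha; rw [hj1]; simp
    · rw [hle a ha]; simp [ha]
  exact ⟨j, i, Subtype.ext (Subtype.ext (by simp only [MIdx.two, MIdx.succ, MIdx.one]; rw [← hJ, ← hs]))⟩

theorem two_eq_iff (a b i j : Fin m) : MIdx.two a b = MIdx.two i j ↔ (a = i ∧ b = j) ∨ (a = j ∧ b = i) := by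
  constructor
  · intro h
    have h' : (Pi.single a 1 + Pi.single b 1 : Fin m → ℕ) = Pi.single i 1 + Pi.single j 1 := congrArg (fun J : MIdxTwo m => J.1.1) h
    have ha := congrFun h' a
    have hb := congrFun h' b
    have hi := congrFun h' i
    have hj := congrFun h' j
    simp only [Pi.add_apply, Pi.single_apply] at ha hb hi hj
    grind
  · rintro (⟨rfl, rfl⟩ | ⟨rfl, rfl⟩)
    · rfl
    · exact Subtype.ext (Subtype.ext (add_comm _ _))

theorem nn_sum (I : MIdxTwo m) :
    ∑ i, ∑ j, (if MIdx.two i j = I then 1 / nn i j else (0:ℝ)) = 1 := by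
  obtain ⟨a, b, rfl⟩ := exists_two I
  have h : ∀ i j, (if MIdx.two i j = MIdx.two a b then 1 / nn i j else (0:ℝ)) =
      (if i = a then (if j = b then 1 / nn a b else 0) else 0) +
      (if i = b then (if j = a then (if a = b then 0 else 1 / nn a b) else 0) else 0) := by
    intro i j
    simp only [two_eq_iff, nn]
    split_ifs <;> grind
  refine (Finset.sum_congr rfl fun i _ => Finset.sum_congr rfl fun j _ => h i j).trans ?_
  simp only [Finset.sum_add_distrib]
  have : ∀ a b : Fin m, ∀ r : ℝ, ∑ i, ∑ j, (if i = a then (if j = b then r else 0) else 0) = r := by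
    intro a b r; simp
  rw [this, this, nn]
  split_ifs <;> norm_num

theorem sum_two (G : MIdxTwo m → ℝ) :
    ∑ I, G I = ∑ i, ∑ j, 1 / nn i j * G (MIdx.two i j) := by
  have h : ∀ I, G I = ∑ i, ∑ j, if MIdx.two i j = I then 1 / nn i j * G I else 0 := by
    intro I
    conv_lhs => rw [← one_mul (G I), ← nn_sum I]
    simp only [Finset.sum_mul, ite_mul, zero_mul]
  rw [Finset.sum_congr rfl fun I _ => h I, Finset.sum_comm]
  refine Finset.sum_congr rfl fun i _ => ?_
  rw [Finset.sum_comm]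
  refine Finset.sum_congr rfl fun j _ => ?_
  rw [Finset.sum_ite_eq]; simp

theorem coupling_eq (w : WModel m n) : coupling w =
    w.2.1 + (∑ i, ∑ α, w.2.2.1 i α * w.1.2 (MIdx.one 2 i) α)
      + (∑ I : MIdxTwo m, ∑ α, w.2.2.2 I α * w.1.2 ⟨I.1.1, I.1.2.trans (by norm_num)⟩ α) := by
  have hv : ∀ i : Fin m, (holonomicLift (k := 1) (truncate (by norm_num) w.1 : JetModel m n 2)
      (Pi.single i 1)).1 = Pi.single i 1 := fun i => rfl
  simp only [coupling, momentumForm, ContinuousAlternatingMap.add_apply,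
    ContinuousAlternatingMap.sum_apply, ContinuousAlternatingMap.smul_apply]
  rw [wedge_dx _ hv]
  simp_rw [wedge_update _ _ _ hv]
  congr 1
  · congr 1
    · simp
    · refine Finset.sum_congr rfl fun i _ => Finset.sum_congr rfl fun α _ => ?_
      have : ((MIdx.zero 1).succ i : MIdx m 2) = MIdx.one 1 i := by
        apply Subtype.ext; simp [MIdx.succ, MIdx.zero, MIdx.one]
      simp [du, holonomicLift_single, this, truncate]
      left; rfl
  · rw [sum_two]
    refine Finset.sum_congr rfl fun i _ => Finset.sum_congr rfl fun j _ => ?_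
    rw [Finset.mul_sum]
    refine Finset.sum_congr rfl fun α _ => ?_
    rw [smul_eq_mul, mul_assoc]
    congr 2
    change (holonomicLift _ _).2 _ α = _
    rw [holonomicLift_single]
    rfl

/-- The Hamiltonian submanifold `𝒲_o ⊂ 𝒲`, where `Ĉ = L̂`. -/
def hamiltonSubmanifold (L : JetModel m n 2 → ℝ) : Set (WModel m n) :=
  {w | coupling w = L (truncate (by norm_num) w.1)}

/-- `ĥ` is the section of `𝒲 → 𝒲_r` induced by `𝒲_o`: its image is `𝒲_o`. -/
theorem mem_hamiltonSubmanifold (L : JetModel m n 2 → ℝ) (w : WModel m n) :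
    w ∈ hamiltonSubmanifold L ↔ hamiltonSection L (w.1, w.2.2) = w := by
  have h : w ∈ hamiltonSubmanifold L ↔ -hamiltonian L (w.1, w.2.2) = w.2.1 := by
    change coupling w = L _ ↔ _
    rw [coupling_eq, hamiltonian]
    constructor <;> intro h <;> linarith
  rw [h]
  exact ⟨fun h => Prod.ext rfl (Prod.ext h rfl), fun h => congrArg (fun w => w.2.1) h⟩

/-- The form `Ω_r = ĥ^* Ω` on `𝒲_r`. -/
def omegaR (L : JetModel m n 2 → ℝ) : WrModel m n → WrModel m n [⋀^Fin (m + 1)]→L[ℝ] ℝ :=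
  pullback (hamiltonSection L) unifiedOmega

/-- The restricted Legendre map in momentum coordinates:
`p^i_α = ∂L/∂u^α_i - ∑_j (1/n(ij)) d/dx^j (∂L/∂u^α_{1_i+1_j})` and `p^I_α = ∂L/∂u^α_I`. -/
def legendreMom (L : JetModel m n 2 → ℝ) (q : JetModel m n 3) : RMom m n :=
  (fun i α => pderivU L (MIdx.one 1 i) α (truncate (by norm_num) q)
      - ∑ j, 1 / nn i j * totalDeriv j (pderivU L (MIdx.two i j).1 α) q,
    fun I α => pderivU L I.1 α (truncate (by norm_num) q))

/-- The extended Legendre map `J^3π → J^2π^†`: the momenta `p^i_α`, `p^I_α` are those of the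
restricted Legendre map and `p = L - p^i_α u^α_i - p^I_α u^α_I`. -/
def extendedLegendre (L : JetModel m n 2 → ℝ) (q : JetModel m n 3) : DagModel m n :=
  (truncate (by norm_num) q, -hamiltonian L (q, legendreMom L q), legendreMom L q)

/-- The Poincaré–Cartan form: the pull-back of `Ω_1^s` by the extended Legendre map. -/
def omegaL (L : JetModel m n 2 → ℝ) : JetModel m n 3 → JetModel m n 3 [⋀^Fin (m + 1)]→L[ℝ] ℝ :=
  pullback (extendedLegendre L) liouvilleOmega

/-- The momentum coordinates `p^i_α` of an `m`-form on `J^1π`. -/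
def momOne (ζ : JetModel m n 1 [⋀^Fin m]→L[ℝ] ℝ) (i : Fin m) (α : Fin n) : ℝ :=
  ζ (Function.update vecx i (vecu (MIdx.zero 1) α))

/-- The momentum coordinates `p^{ij}_α` of an `m`-form on `J^1π`. -/
def momTwo (ζ : JetModel m n 1 [⋀^Fin m]→L[ℝ] ℝ) (i j : Fin m) (α : Fin n) : ℝ :=
  ζ (Function.update vecx j (vecu (MIdx.one 0 i) α))

/-- The coordinates `(p^i_α, p^I_α)` of a 2-symmetric `m`-form on `J^1π`; here
`p^{1_i+1_j}_α = n(ij) p^{ij}_α`, so that `p^I_α` is the sum of the `p^{ij}_α` with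
`1_i + 1_j = I`. -/
def momCoord (ζ : JetModel m n 1 [⋀^Fin m]→L[ℝ] ℝ) : RMom m n :=
  (fun i α => momOne ζ i α,
    fun I α => ∑ i, ∑ j, if MIdx.two i j = I then momTwo ζ i j α else 0)

end Forms

/-! ### Multimomentum bundles, sections and field equations -/

section Sections

variable {m n : ℕ} {M E : Type*}
  [TopologicalSpace M] [ChartedSpace (Base m) M]
  [TopologicalSpace E] [ChartedSpace (Base m × Fibre n) E]
  {B : ConfigBundle m n M E}

/-- The space `Λ^m(T_u^* J^1π)` of alternating `m`-forms on the tangent space of `J^1π` at `u`. Such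
a form is given by its components in all the induced charts around `u`, which are related by the
changes of coordinates (the components in the other charts are set to be zero). -/
def formsAt (u : Jet B 1) :
    Submodule ℝ (AdaptedChart B → JetModel m n 1 [⋀^Fin m]→L[ℝ] ℝ) where
  carrier := {ζ | (∀ c : AdaptedChart B, u ∉ c.jetSource 1 → ζ c = 0) ∧
    ∀ c c' : AdaptedChart B, u ∈ c.jetSource 1 → u ∈ c'.jetSource 1 →
      ζ c = (ζ c').compContinuousLinearMap (fderiv ℝ (c.jetTransition c' 1) (c.jetCoord u))}
  zero_mem' := ⟨fun _ _ => rfl, fun _ _ _ _ => rfl⟩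
  add_mem' := fun ha hb => ⟨fun c hc => by simp [ha.1 c hc, hb.1 c hc],
    fun c c' hc hc' => by
      rw [Pi.add_apply, ha.2 c c' hc hc', hb.2 c c' hc hc']; rfl⟩
  smul_mem' := fun r _ ha => ⟨fun c hc => by simp [ha.1 c hc],
    fun c c' hc hc' => by rw [Pi.smul_apply, ha.2 c c' hc hc']; rfl⟩

/-- The fibre at `u` of the extended 2-symmetric multimomentum bundle `J^2π^†`: the `m`-forms at `u`
that vanish on two vectors vertical over `M` and satisfy `p^{ij}_α = p^{ji}_α`. -/
def dagFibre (u : Jet B 1) :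
    Submodule ℝ (AdaptedChart B → JetModel m n 1 [⋀^Fin m]→L[ℝ] ℝ) where
  carrier := {ζ | ζ ∈ formsAt u ∧ ∀ c : AdaptedChart B,
    (∀ v : Fin m → JetModel m n 1, (∃ a b, a ≠ b ∧ (v a).1 = 0 ∧ (v b).1 = 0) → ζ c v = 0) ∧
    ∀ i j α, momTwo (ζ c) i j α = momTwo (ζ c) j i α}
  zero_mem' := ⟨Submodule.zero_mem _, fun _ => ⟨fun _ _ => rfl, fun _ _ _ => rfl⟩⟩
  add_mem' := fun {a b} ha hb => ⟨Submodule.add_mem _ ha.1 hb.1, fun c =>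
    ⟨fun v hv => by
      change a c v + b c v = 0
      rw [(ha.2 c).1 v hv, (hb.2 c).1 v hv, add_zero],
    fun i j α => congrArg₂ (· + ·) ((ha.2 c).2 i j α) ((hb.2 c).2 i j α)⟩⟩
  smul_mem' := fun r a ha => ⟨Submodule.smul_mem _ r ha.1, fun c =>
    ⟨fun v hv => by
      change r • a c v = 0
      rw [(ha.2 c).1 v hv, smul_zero],
    fun i j α => congrArg (r • ·) ((ha.2 c).2 i j α)⟩⟩

/-- The fibre at `u` of `Λ^m_1(J^1π)`: the semibasic `m`-forms, which vanish on one vector vertical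
over `M`. -/
def semibasicFibre (u : Jet B 1) :
    Submodule ℝ (AdaptedChart B → JetModel m n 1 [⋀^Fin m]→L[ℝ] ℝ) where
  carrier := {ζ | ζ ∈ formsAt u ∧ ∀ c : AdaptedChart B, ∀ v : Fin m → JetModel m n 1,
    (∃ a, (v a).1 = 0) → ζ c v = 0}
  zero_mem' := ⟨Submodule.zero_mem _, fun _ _ _ => rfl⟩
  add_mem' := fun {a b} ha hb => ⟨Submodule.add_mem _ ha.1 hb.1, fun c v hv => by
    change a c v + b c v = 0
    rw [ha.2 c v hv, hb.2 c v hv, add_zero]⟩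
  smul_mem' := fun r a ha => ⟨Submodule.smul_mem _ r ha.1, fun c v hv => by
    change r • a c v = 0
    rw [ha.2 c v hv, smul_zero]⟩

/-- Two 2-symmetric forms at `u` are identified in `J^2π^‡ = J^2π^† / Λ^m_1(J^1π)` if their
difference is semibasic. -/
def ddagSetoid (u : Jet B 1) : Setoid (dagFibre u) where
  r a b := a.1 - b.1 ∈ semibasicFibre u
  iseqv :=
    { refl := fun a => by rw [sub_self]; exact Submodule.zero_mem _
      symm := fun {a b} h => by
        have h' := Submodule.smul_mem _ (-1 : ℝ) h
        rwa [neg_one_smul, neg_sub] at h'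
      trans := fun {a b d} h h' => by
        have h'' := Submodule.add_mem _ h h'
        rwa [sub_add_sub_cancel] at h'' }

/-- The fibre at `u` of the restricted 2-symmetric multimomentum bundle `J^2π^‡`. -/
def DdagFibre (u : Jet B 1) := Quotient (ddagSetoid u)

variable (B) in
/-- The restricted 2-symmetric jet-multimomentum bundle `𝒲_r = J^3π ×_{J^1π} J^2π^‡`; the field
`jet` is the projection `ρ_1^r : 𝒲_r → J^3π`. -/
structure Wr where
  jet : Jet B 3
  mom : DdagFibre (jet.proj (show 1 ≤ 3 by norm_num))

namespace AdaptedChart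

/-- The induced coordinates `(x^i, u^α_I, p^i_α, p^I_α)` on `𝒲_r`. -/
def wrCoord (c : AdaptedChart B) (w : Wr B) : WrModel m n :=
  (c.jetCoord w.jet, momCoord ((Quotient.out w.mom).1 c))

/-- The image of the induced coordinates on `𝒲_r`. -/
def wrTarget (c : AdaptedChart B) : Set (WrModel m n) := {w | w.1 ∈ c.jetTarget 3}

/-- The set of the points of `M`, in coordinates, where the expression in the chart `c` of a section
over `U` is defined; `σ` is the projection of the section to `E`. -/
def sectionDomain (c : AdaptedChart B) (U : Set M) (σ : M → E) : Set (Base m) :=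
  {y | y ∈ c.base.target ∧ c.base.symm y ∈ U ∧ σ (c.base.symm y) ∈ c.tot.source}

end AdaptedChart

/-- Smooth sections over `U` of the projection `J^3π → M`. -/
def IsJetSection (U : Set M) (ψ : M → Jet B 3) : Prop :=
  (∀ x ∈ U, (ψ x).point = x) ∧ ContinuousOn (fun x => (ψ x).value) U ∧
    ∀ c : AdaptedChart B, ContDiffOn ℝ ∞ (fun y => c.jetCoord (ψ (c.base.symm y)))
      (c.sectionDomain U fun x => (ψ x).value)

/-- Smooth sections over `U` of the projection `𝒲_r → M`. -/
def IsWrSection (U : Set M) (ψ : M → Wr B) : Prop :=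
  (∀ x ∈ U, (ψ x).jet.point = x) ∧ ContinuousOn (fun x => (ψ x).jet.value) U ∧
    ∀ c : AdaptedChart B, ContDiffOn ℝ ∞ (fun y => c.wrCoord (ψ (c.base.symm y)))
      (c.sectionDomain U fun x => (ψ x).jet.value)

/-- Holonomic sections of `J^3π → M` over `U`: those with `ψ = j^3φ`, where `φ = π^3 ∘ ψ`. -/
def IsHolonomic (U : Set M) (ψ : M → Jet B 3) : Prop :=
  ∀ x ∈ U, ∃ h : IsSectionNear B x (fun y => (ψ y).value),
    ψ x = Jet.mk 3 x (fun y => (ψ y).value) h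

/-- Holonomic sections of `𝒲_r → M` over `U`: those whose projection to `J^3π` is holonomic. -/
def IsWrHolonomic (U : Set M) (ψ : M → Wr B) : Prop := IsHolonomic U fun x => (ψ x).jet

/-- The unified field equation `ψ^* i(X)Ω_r = 0` for every vector field `X` on `𝒲_r`; being local
in `X`, it is required in every induced chart, for every smooth `X` on the domain of the chart. -/
def SolvesUnified (η : VolumeForm m M) (L : Jet B 2 → ℝ) (U : Set M) (ψ : M → Wr B) : Prop :=
  ∀ c : AdaptedChart B, ∀ X : WrModel m n → WrModel m n, ContDiffOn ℝ ∞ X c.wrTarget →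
    ∀ y ∈ c.sectionDomain U (fun x => (ψ x).jet.value),
      pullback (fun y => c.wrCoord (ψ (c.base.symm y)))
        (contract X (omegaR (c.lagrangian η L))) y = 0

/-- The Lagrangian field equation `ψ^* i(X)Ω_ℒ = 0` for every vector field `X` on `J^3π`. -/
def SolvesLagrangian (η : VolumeForm m M) (L : Jet B 2 → ℝ) (U : Set M) (ψ : M → Jet B 3) : Prop :=
  ∀ c : AdaptedChart B, ∀ X : JetModel m n 3 → JetModel m n 3, ContDiffOn ℝ ∞ X (c.jetTarget 3) →
    ∀ y ∈ c.sectionDomain U (fun x => (ψ x).value),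
      pullback (fun y => c.jetCoord (ψ (c.base.symm y)))
        (contract X (omegaL (c.lagrangian η L))) y = 0

end Sections

end SecondOrderField

end

namespace SecondOrderField

/-! ### The Liouville form in coordinates -/

section Liouville

variable {m n : ℕ}

/-! Write `leg` for the restricted Legendre map and `γ(q) = (q, leg q)` for its graph map into
`𝒲_r`. The extended Legendre map is `ρ_2 ∘ ĥ ∘ γ`, so `Ω_ℒ = γ^*Ω_r`. If `ψ` takes its values in the
graph, then `ψ = γ ∘ ψ_ℒ`, and `ψ_ℒ^* i(X)Ω_ℒ` at a point is `Ω_r` contracted with the vector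
`Tγ(X)` and pulled back by `ψ`. This vanishes by the unified equation (`omegaL_eq_omegaR`). The
equation only involves the value of the vector field at the point, so `Tγ(X)` is extended as a
constant field and needs no extension off the graph.

It remains to see that `ψ` lies in the graph (`mom_eq_legendreMom_of_unified`). Contracting with
`∂/∂u^α_I`, `|I| = 2`, gives `p^I_α = ∂L/∂u^α_I`, and contracting with `∂/∂u^α_i` gives `p^i_α =
∂L/∂u^α_i - ∑_j (1/n(ij)) ∂p^{1_i+1_j}_α/∂x^j`. The first relation holds on an open set, so it may
be differentiated along `ψ`; holonomy turns the resulting derivatives into total derivatives, and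
the second relation becomes the formula for the Legendre map.

The contractions are computable because `Θ_1^s` is linear in the momenta and its coefficients
involve no other coordinate: `Ω_1^s` has constant coefficients, with the explicit value of
`liouvilleOmega_vertical` on vertical vectors. -/

theorem momentumForm_add (P Q : XMom m n) :
    momentumForm (P + Q) = momentumForm P + momentumForm Q := by
  ext v
  simp only [momentumForm, ContinuousAlternatingMap.add_apply,
    ContinuousAlternatingMap.sum_apply, ContinuousAlternatingMap.smul_apply, smul_eq_mul,
    Prod.fst_add, Prod.snd_add, Pi.add_apply, add_mul, mul_add, Finset.sum_add_distrib]
  ring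

theorem momentumForm_smul (r : ℝ) (P : XMom m n) :
    momentumForm (r • P) = r • momentumForm P := by
  ext v
  simp only [momentumForm, ContinuousAlternatingMap.add_apply,
    ContinuousAlternatingMap.sum_apply, ContinuousAlternatingMap.smul_apply, smul_eq_mul,
    Prod.smul_fst, Prod.smul_snd, Pi.smul_apply, mul_add, Finset.mul_sum]
  congr 1
  · congr 1
    · ring
    · exact Finset.sum_congr rfl fun _ _ => Finset.sum_congr rfl fun _ _ => by ring
  · exact Finset.sum_congr rfl fun _ _ => Finset.sum_congr rfl fun _ _ =>
      Finset.sum_congr rfl fun _ _ => by ring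

/-- The tautological form is linear in the point of the coordinate space, hence equal to its own
derivative. -/
theorem fderiv_liouville_apply (z w : DagModel m n) : fderiv ℝ liouville z w = liouville w := by
  let ℓ : DagModel m n →ₗ[ℝ] DagModel m n [⋀^Fin m]→L[ℝ] ℝ :=
    { toFun := liouville
      map_add' := fun a b => by
        ext v
        simp [liouville, momentumForm_add]
      map_smul' := fun r a => by
        ext v
        simp [liouville, momentumForm_smul] }
  have h : (liouville : DagModel m n → _) = LinearMap.toContinuousLinearMap ℓ := rfl
  rw [h, ContinuousLinearMap.fderiv]

/-- In the alternating sum for `dΘ_1^s`, each term differentiates along one argument. The term for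
`u a` leaves `Y` in front, and moving `Y` to the place vacated by `u a` absorbs its sign. -/
theorem liouvilleOmega_vecCons (z Y : DagModel m n) (u : Fin m → DagModel m n) :
    liouvilleOmega z (Matrix.vecCons Y u) =
      -momentumForm Y.2 (fun b => (u b).1)
        + ∑ a, momentumForm (u a).2 (Function.update (fun b => (u b).1) a Y.1) := by
  rw [liouvilleOmega, ContinuousAlternatingMap.neg_apply, extDeriv,
    ContinuousAlternatingMap.alternatizeUncurryFin_apply, Fin.sum_univ_succ, neg_add]
  congr 1
  · rw [fderiv_liouville_apply]
    simp [liouville]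
    rfl
  · rw [← Finset.sum_neg_distrib]
    refine Finset.sum_congr rfl fun a _ => ?_
    rw [fderiv_liouville_apply]
    -- Inserting at position `a` needs a nonempty index type; for `m = 0` there is no `a`.
    obtain _ | m := m
    · exact a.elim0
    have h₁ : Fin.removeNth a.succ (Matrix.vecCons Y u) = Matrix.vecCons Y (a.removeNth u) := by
      funext b
      refine Fin.cases ?_ (fun b => ?_) b
      · simp [Fin.removeNth]
      · simp [Fin.removeNth]
    have h₂ : Function.update (fun b => (u b).1) a Y.1 =
        fun b => (a.insertNth Y (a.removeNth u) b).1 := by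
      funext b
      rw [Fin.insertNth_removeNth]
      by_cases h : b = a
      · subst h; simp
      · simp [h]
    have h₃ := (liouville (u a)).map_insertNth a Y (a.removeNth u)
    rw [h₁, h₂]
    change _ = liouville (u a) (a.insertNth Y (a.removeNth u))
    rw [h₃]
    -- The sign `(-1)^(a+1)` of the exterior derivative, with the minus of `Ω_1^s = -dΘ_1^s`, is
    -- `(-1)^a`, the sign of moving `Y` into place `a`.
    simp [pow_succ]

/-- The coefficients are constant, so base points can be dropped when pulling back `Ω_1^s`. -/
theorem liouvilleOmega_eq (z z' : DagModel m n) : liouvilleOmega z = liouvilleOmega z' := by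
  ext v
  rw [← Matrix.cons_head_tail v, liouvilleOmega_vecCons, liouvilleOmega_vecCons]

theorem momentumForm_of_fst_eq (P : XMom m n) (v : Fin m → JetModel m n 1)
    (hv : ∀ i, (v i).1 = Pi.single i 1) :
    momentumForm P v = P.1 + ∑ i, ∑ α, P.2.1 i α * (v i).2 (MIdx.zero 1) α
      + ∑ i, ∑ j, ∑ α, (1 / nn i j * P.2.2 (MIdx.two i j) α) * (v j).2 (MIdx.one 0 i) α := by
  simp only [momentumForm, ContinuousAlternatingMap.add_apply,
    ContinuousAlternatingMap.sum_apply, ContinuousAlternatingMap.smul_apply, smul_eq_mul]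
  rw [wedge_dx _ hv]
  simp_rw [wedge_update _ _ _ hv]
  simp [du]

/-- Adding a vertical vector to one member of the frame does not change its projection to `M`. By
multilinearity the value sought is therefore a difference of two values given by
`momentumForm_of_fst_eq`. -/
theorem momentumForm_update (P : XMom m n) (v : Fin m → JetModel m n 1)
    (hv : ∀ i, (v i).1 = Pi.single i 1) (a : Fin m) (Y : JetModel m n 1) (hY : Y.1 = 0) :
    momentumForm P (Function.update v a Y) = ∑ α, P.2.1 a α * Y.2 (MIdx.zero 1) α
      + ∑ i, ∑ α, (1 / nn i a * P.2.2 (MIdx.two i a) α) * Y.2 (MIdx.one 0 i) α := by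
  have h₁ := (momentumForm P).map_update_add v a (v a) Y
  rw [Function.update_eq_self] at h₁
  have hv' : ∀ i, (Function.update v a (v a + Y) i).1 = Pi.single i 1 := by
    intro i
    by_cases h : i = a
    · subst h; simp [hY, hv]
    · simp [h, hv]
  have h₂ : momentumForm P (Function.update v a Y) =
      momentumForm P (Function.update v a (v a + Y)) - momentumForm P v := by
    rw [h₁]; ring
  have key : ∀ (j : Fin m) (I : MIdx m 1) (α : Fin n),
      (Function.update v a (v a + Y) j).2 I α = (v j).2 I α + if j = a then Y.2 I α else 0 := by
    intro j I α
    by_cases h : j = a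
    · subst h; simp
    · simp [h]
  rw [h₂, momentumForm_of_fst_eq _ _ hv', momentumForm_of_fst_eq _ _ hv]
  simp only [key, mul_add, Finset.sum_add_distrib, mul_ite, mul_zero]
  have e₁ : ∑ i, ∑ α, (if i = a then P.2.1 i α * Y.2 (MIdx.zero 1) α else 0)
      = ∑ α, P.2.1 a α * Y.2 (MIdx.zero 1) α := by
    rw [Finset.sum_eq_single a] <;> simp +contextual
  have e₂ : ∑ i, ∑ j, ∑ α, (if j = a then
        1 / nn i j * P.2.2 (MIdx.two i j) α * Y.2 (MIdx.one 0 i) α else 0)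
      = ∑ i, ∑ α, 1 / nn i a * P.2.2 (MIdx.two i a) α * Y.2 (MIdx.one 0 i) α := by
    refine Finset.sum_congr rfl fun i _ => ?_
    rw [Finset.sum_eq_single a] <;> simp +contextual
  rw [e₁, e₂]
  ring

/-- The contraction of `Ω_1^s` with a vector vertical over `M`, on a frame over the coordinate
frame of `M`. -/
theorem liouvilleOmega_vertical (z Y : DagModel m n) (hY : Y.1.1 = 0) (u : Fin m → DagModel m n)
    (hu : ∀ i, (u i).1.1 = Pi.single i 1) (hY₂ : Y.2.2 = 0) :
    liouvilleOmega z (Matrix.vecCons Y u) =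
      -Y.2.1 + ∑ a, (∑ α, (u a).2.2.1 a α * Y.1.2 (MIdx.zero 1) α
        + ∑ i, ∑ α, (1 / nn i a * (u a).2.2.2 (MIdx.two i a) α) * Y.1.2 (MIdx.one 0 i) α) := by
  rw [liouvilleOmega_vecCons, momentumForm_of_fst_eq _ _ hu]
  simp_rw [momentumForm_update _ (fun b => (u b).1) hu _ Y.1 hY]
  simp [hY₂]

end Liouville

end SecondOrderField

namespace SecondOrderField

/-! ### Iterated partial derivatives -/

section PartialDerivatives

variable {m n : ℕ}

theorem contDiffOn_pderiv {O : Set (Base m)} (hO : IsOpen O) (i : Fin m) {s : Base m → Fibre n}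
    (hs : ContDiffOn ℝ ∞ s O) : ContDiffOn ℝ ∞ (pderiv i s) O :=
  (hs.fderiv_of_isOpen hO (by simp)).clm_apply contDiffOn_const

theorem contDiffOn_foldr_pderiv {O : Set (Base m)} (hO : IsOpen O) {s : Base m → Fibre n}
    (hs : ContDiffOn ℝ ∞ s O) (l : List (Fin m)) : ContDiffOn ℝ ∞ (l.foldr pderiv s) O := by
  induction l with
  | nil => exact hs
  | cons i l ih => exact contDiffOn_pderiv hO i ih

theorem pderiv_congr {O : Set (Base m)} (hO : IsOpen O) (i : Fin m) {s t : Base m → Fibre n}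
    (h : Set.EqOn s t O) : Set.EqOn (pderiv i s) (pderiv i t) O := fun x hx => by
  have : s =ᶠ[𝓝 x] t := Filter.eventuallyEq_of_mem (hO.mem_nhds hx) h
  simp only [pderiv, this.fderiv_eq]

theorem pderiv_comm {O : Set (Base m)} (hO : IsOpen O) (i j : Fin m) {s : Base m → Fibre n}
    (hs : ContDiffOn ℝ ∞ s O) : Set.EqOn (pderiv i (pderiv j s)) (pderiv j (pderiv i s)) O := by
  intro x hx
  have hx' := hO.mem_nhds hx
  have hd : DifferentiableAt ℝ (fderiv ℝ s) x :=
    ((hs.fderiv_of_isOpen hO (m := ∞) (by simp)).differentiableOn (by simp)).differentiableAt hx'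
  have key : ∀ a b : Fin m, pderiv a (pderiv b s) x =
      fderiv ℝ (fderiv ℝ s) x (Pi.single a 1) (Pi.single b 1) := by
    intro a b
    change fderiv ℝ (fun y => fderiv ℝ s y (Pi.single b 1)) x (Pi.single a 1) = _
    rw [fderiv_clm_apply hd (differentiableAt_const _)]
    simp
  rw [key, key]
  have h₂ : minSmoothness ℝ 2 ≤ (∞ : ℕ∞ω) := by
    simp only [minSmoothness_of_isRCLikeNormedField]
    exact WithTop.coe_le_coe.2 (le_top : (2 : ℕ∞) ≤ ⊤)
  exact (hs.contDiffAt hx').isSymmSndFDerivAt h₂ _ _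

/-- Adjacent derivatives commute by symmetry of the second derivative, and adjacent swaps generate
all permutations. -/
theorem foldr_pderiv_perm {O : Set (Base m)} (hO : IsOpen O) {s : Base m → Fibre n}
    (hs : ContDiffOn ℝ ∞ s O) {l l' : List (Fin m)} (h : l.Perm l') :
    Set.EqOn (l.foldr pderiv s) (l'.foldr pderiv s) O := by
  induction h with
  | nil => exact fun _ _ => rfl
  | cons i _ ih => exact pderiv_congr hO i ih
  | swap i j l => exact pderiv_comm hO _ _ (contDiffOn_foldr_pderiv hO hs l)
  | trans _ _ ih ih' => exact ih.trans ih'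

theorem count_flatMap_replicate (I : Fin m → ℕ) (a : Fin m) :
    ((List.finRange m).flatMap fun i => List.replicate (I i) i).count a = I a := by
  rw [List.count_flatMap]
  have : (List.count a ∘ fun i => List.replicate (I i) i) = fun i => if i = a then I i else 0 := by
    funext i
    simp [List.count_replicate]
  rw [this, ← Fin.sum_univ_def]
  simp

/-- `partialDeriv` differentiates in a fixed order; prefixing `i` breaks that order but gives the
same multiset of indices as `I + 1_i`. -/
theorem pderiv_partialDeriv {O : Set (Base m)} (hO : IsOpen O) (I : Fin m → ℕ) (i : Fin m)
    {s : Base m → Fibre n} (hs : ContDiffOn ℝ ∞ s O) :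
    Set.EqOn (pderiv i (partialDeriv I s)) (partialDeriv (I + Pi.single i 1) s) O := by
  refine foldr_pderiv_perm hO hs (l := i :: _) (List.perm_iff_count.2 fun a => ?_)
  rw [List.count_cons, count_flatMap_replicate, count_flatMap_replicate]
  by_cases h : a = i
  · subst h; simp
  · simp [h, Ne.symm h]

end PartialDerivatives

end SecondOrderField

namespace SecondOrderField

/-! ### The field equations in coordinates -/

section FieldEquations

variable {m n : ℕ}

/-- The projection `truncate`, as a continuous linear map. -/
def truncateCLM {k l : ℕ} (h : l ≤ k) : JetModel m n k →L[ℝ] JetModel m n l :=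
  (ContinuousLinearMap.fst ℝ _ _).prod (ContinuousLinearMap.pi fun I : MIdx m l =>
    (ContinuousLinearMap.proj (φ := fun _ : MIdx m k => Fibre n) ⟨I.1, I.2.trans h⟩).comp
      (ContinuousLinearMap.snd ℝ (Base m) (MIdx m k → Fibre n)))

theorem truncate_vecu_of_le {k l : ℕ} (h : l ≤ k) (I : MIdx m l) (α : Fin n) :
    truncate h (vecu ⟨I.1, I.2.trans h⟩ α) = vecu I α := by
  refine Prod.ext rfl (funext fun J => ?_)
  simp only [truncate, vecu, Pi.single_apply, Subtype.ext_iff]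

theorem truncate_vecu_of_lt {k l : ℕ} (h : l ≤ k) (I : MIdx m k) (hI : l < ∑ i, I.1 i)
    (α : Fin n) : truncate h (vecu I α) = 0 := by
  refine Prod.ext rfl (funext fun J => ?_)
  have : (⟨J.1, J.2.trans h⟩ : MIdx m k) ≠ I := by
    rintro rfl
    exact absurd J.2 (not_le.2 hI)
  simp [truncate, vecu, this]

theorem vecu_snd_apply {k : ℕ} (I J : MIdx m k) (α β : Fin n) :
    (vecu I α : JetModel m n k).2 J β = if J = I ∧ β = α then 1 else 0 := by
  by_cases h : J = I
  · subst h; simp [vecu, Pi.single_apply]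
  · simp [vecu, h]

theorem differentiableAt_hamiltonian {L : JetModel m n 2 → ℝ} {w : WrModel m n}
    (hL : DifferentiableAt ℝ L (truncate (by norm_num) w.1)) :
    DifferentiableAt ℝ (hamiltonian L) w := by
  have h : DifferentiableAt ℝ (fun w : WrModel m n => L (truncate (by norm_num) w.1)) w :=
    DifferentiableAt.comp w (f := fun w : WrModel m n => truncateCLM (by norm_num) w.1) hL
      (by fun_prop)
  exact DifferentiableAt.sub (by fun_prop) h

/-- With the momenta held fixed, `Ĥ + L` is affine along the line through `w`. The directional
derivative is read off on this line and compared by uniqueness. -/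
theorem fderiv_hamiltonian_apply {L : JetModel m n 2 → ℝ} {w : WrModel m n}
    (hL : DifferentiableAt ℝ L (truncate (by norm_num) w.1)) (v : JetModel m n 3) :
    fderiv ℝ (hamiltonian L) w (v, 0) = (∑ i, ∑ α, w.2.1 i α * v.2 (MIdx.one 2 i) α)
      + (∑ I : MIdxTwo m, ∑ α, w.2.2 I α * v.2 ⟨I.1.1, I.1.2.trans (by norm_num)⟩ α)
      - fderiv ℝ L (truncate (by norm_num) w.1) (truncate (by norm_num) v) := by
  have h₁ : HasLineDerivAt ℝ L (fderiv ℝ L (truncate (by norm_num) w.1) (truncate (by norm_num) v))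
      (truncate (by norm_num) w.1) (truncate (by norm_num) v) := hL.hasFDerivAt.hasLineDerivAt _
  have h₂ := (differentiableAt_hamiltonian hL).hasFDerivAt.hasLineDerivAt (v, 0)
  unfold HasLineDerivAt at h₁ h₂
  set A := (∑ i, ∑ α, w.2.1 i α * v.2 (MIdx.one 2 i) α)
      + (∑ I : MIdxTwo m, ∑ α, w.2.2 I α * v.2 ⟨I.1.1, I.1.2.trans (by norm_num)⟩ α) with hA
  set B := (∑ i, ∑ α, w.2.1 i α * w.1.2 (MIdx.one 2 i) α)
      + (∑ I : MIdxTwo m, ∑ α, w.2.2 I α * w.1.2 ⟨I.1.1, I.1.2.trans (by norm_num)⟩ α) with hB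
  have h₃ : (fun t : ℝ => hamiltonian L (w + t • ((v, 0) : WrModel m n))) =
      fun t => B + t * A - L (truncate (by norm_num) w.1 + t • truncate (by norm_num) v) := by
    funext t
    have e : truncate (by norm_num) w.1 + t • truncate (by norm_num) v =
      (truncate (by norm_num) (w.1 + t • v) : JetModel m n 2) := rfl
    rw [e, hA, hB]
    simp only [hamiltonian, Prod.fst_add, Prod.snd_add, Prod.smul_fst, Prod.smul_snd, smul_zero,
      add_zero, Pi.add_apply, Pi.smul_apply, smul_eq_mul, mul_add, Finset.sum_add_distrib,
      Finset.mul_sum]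
    simp only [mul_left_comm t]
    ring
  rw [h₃] at h₂
  have h₄ : HasDerivAt (fun t : ℝ => B + t * A) A 0 := by
    simpa using ((hasDerivAt_id (0 : ℝ)).mul_const A).const_add B
  exact h₂.unique (h₄.sub h₁)

/-- The tangent map at `w` of `ρ_2 ∘ ĥ : 𝒲_r → J^2π^†`. -/
noncomputable def hamiltonTangent (L : JetModel m n 2 → ℝ) (w X : WrModel m n) : DagModel m n :=
  (truncate (by norm_num) X.1, -fderiv ℝ (hamiltonian L) w X, X.2)

theorem hasFDerivAt_hamiltonSection {L : JetModel m n 2 → ℝ} {w : WrModel m n}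
    (hL : DifferentiableAt ℝ L (truncate (by norm_num) w.1)) :
    HasFDerivAt (hamiltonSection L) ((ContinuousLinearMap.fst ℝ _ _).prod
      ((-fderiv ℝ (hamiltonian L) w).prod (ContinuousLinearMap.snd ℝ _ _))) w :=
  hasFDerivAt_fst.prodMk ((differentiableAt_hamiltonian hL).hasFDerivAt.neg.prodMk hasFDerivAt_snd)

theorem hasFDerivAt_rhoTwo (w : WModel m n) :
    HasFDerivAt rhoTwo (((truncateCLM (by norm_num)).comp (ContinuousLinearMap.fst ℝ _ _)).prod
      (ContinuousLinearMap.snd ℝ _ _) : WModel m n →L[ℝ] DagModel m n) w :=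
  (((truncateCLM (by norm_num)).comp (ContinuousLinearMap.fst ℝ _ _)).prod
    (ContinuousLinearMap.snd ℝ _ _) : WModel m n →L[ℝ] DagModel m n).hasFDerivAt

/-- Chain rule for `ρ_2 ∘ ĥ`; the base point becomes `0` because `Ω_1^s` has constant coefficients.
-/
theorem omegaR_apply {L : JetModel m n 2 → ℝ} {w : WrModel m n}
    (hL : DifferentiableAt ℝ L (truncate (by norm_num) w.1)) (v : Fin (m + 1) → WrModel m n) :
    omegaR L w v = liouvilleOmega 0 fun b => hamiltonTangent L w (v b) := by
  simp only [omegaR, unifiedOmega, pullback, (hasFDerivAt_hamiltonSection hL).fderiv,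
    (hasFDerivAt_rhoTwo _).fderiv]
  rw [liouvilleOmega_eq _ 0]
  rfl

theorem contDiffAt_pderivU {k : ℕ} {F : JetModel m n k → ℝ} {q : JetModel m n k}
    (hF : ContDiffAt ℝ ∞ F q) (I : MIdx m k) (α : Fin n) : ContDiffAt ℝ ∞ (pderivU F I α) q :=
  (hF.fderiv_right (by simp)).clm_apply contDiffAt_const

theorem contDiffAt_totalDeriv {k : ℕ} {F : JetModel m n k → ℝ} {q : JetModel m n (k + 1)}
    (hF : ContDiffAt ℝ ∞ F (truncate (Nat.le_succ k) q)) (j : Fin m) :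
    ContDiffAt ℝ ∞ (totalDeriv j F) q := by
  refine ContDiffAt.clm_apply ?_ ?_
  · exact (hF.fderiv_right (m := ∞) (by simp)).comp q
      (truncateCLM (Nat.le_succ k)).contDiff.contDiffAt
  · simp only [holonomicLift]
    fun_prop

theorem contDiffAt_legendreMom {L : JetModel m n 2 → ℝ} {q : JetModel m n 3}
    (hL : ContDiffAt ℝ ∞ L (truncate (by norm_num) q)) : ContDiffAt ℝ ∞ (legendreMom L) q := by
  have h : ∀ I α, ContDiffAt ℝ ∞ (fun q => pderivU L I α (truncate (by norm_num) q)) q :=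
    fun I α => (contDiffAt_pderivU hL I α).comp q (truncateCLM (by norm_num)).contDiff.contDiffAt
  refine ContDiffAt.prodMk (contDiffAt_pi.2 fun i => contDiffAt_pi.2 fun α => ?_)
    (contDiffAt_pi.2 fun I => contDiffAt_pi.2 fun α => h _ _)
  exact (h _ _).sub (ContDiffAt.sum fun j _ =>
    contDiffAt_const.mul (contDiffAt_totalDeriv (contDiffAt_pderivU hL _ _) j))

/-- Chain rule for the factorization of the extended Legendre map through the graph of the
restricted one, which puts `Ω_ℒ` in the same form as `Ω_r` in `omegaR_apply`. -/
theorem omegaL_apply {L : JetModel m n 2 → ℝ} {q : JetModel m n 3}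
    (hL : ContDiffAt ℝ ∞ L (truncate (by norm_num) q)) (v : Fin (m + 1) → JetModel m n 3) :
    omegaL L q v = liouvilleOmega 0 fun b =>
      hamiltonTangent L (q, legendreMom L q) (v b, fderiv ℝ (legendreMom L) q (v b)) := by
  have hleg := ((contDiffAt_legendreMom hL).differentiableAt (by simp)).hasFDerivAt
  have h := (hasFDerivAt_rhoTwo _).comp q ((hasFDerivAt_hamiltonSection (w := (q, legendreMom L q))
    (hL.differentiableAt (by simp))).comp q ((hasFDerivAt_id q).prodMk hleg))
  have h' : fderiv ℝ (extendedLegendre L) q = _ := h.fderiv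
  simp only [omegaL, pullback, h']
  rw [liouvilleOmega_eq _ 0]
  rfl

/-- A solution of the unified equations satisfies `p^I_α = ∂L/∂u^α_I`. -/
theorem mom_two_eq_of_unified {L : JetModel m n 2 → ℝ} {w : WrModel m n}
    (hL : DifferentiableAt ℝ L (truncate (by norm_num) w.1)) {u : Fin m → WrModel m n}
    (hu : ∀ i, (u i).1.1 = Pi.single i 1)
    (h : ∀ X, omegaR L w (Matrix.vecCons X u) = 0) (I : MIdxTwo m) (α : Fin n) :
    w.2.2 I α = pderivU L I.1 α (truncate (by norm_num) w.1) := by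
  -- The contraction is with `∂/∂u^α_I`. It projects to zero on `J^1π`, so only the derivative of
  -- `Ĥ` survives: `p^I_α - ∂L/∂u^α_I = 0`.
  let v : JetModel m n 3 := vecu ⟨I.1.1, I.1.2.trans (by norm_num)⟩ α
  have hX := h (v, 0)
  have e : (fun b => hamiltonTangent L w
        ((Matrix.vecCons (v, 0) u : Fin (m + 1) → WrModel m n) b)) =
      Matrix.vecCons (hamiltonTangent L w (v, 0)) fun b => hamiltonTangent L w (u b) := by
    funext b
    refine Fin.cases rfl (fun _ => rfl) b
  have hv : truncate (by norm_num) v = (0 : JetModel m n 1) :=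
    truncate_vecu_of_lt _ _ (by simp [I.2]) _
  have hv₂ : truncate (by norm_num) v = (vecu I.1 α : JetModel m n 2) :=
    truncate_vecu_of_le (by norm_num) _ _
  have hone : ∀ i, (MIdx.one 2 i : MIdx m 3) ≠ ⟨I.1.1, I.1.2.trans (by norm_num)⟩ := by
    intro i hi
    have := I.2
    rw [← congrArg Subtype.val hi] at this
    simp [MIdx.one] at this
  rw [omegaR_apply hL, e, liouvilleOmega_vertical _ _ (congrArg Prod.fst hv) _ hu rfl] at hX
  simp only [hamiltonTangent, hv, fderiv_hamiltonian_apply hL, hv₂] at hX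
  simp only [v, vecu_snd_apply, hone, Subtype.mk.injEq, ← Subtype.ext_iff] at hX
  have s : ∑ J : MIdxTwo m, ∑ β, w.2.2 J β * (if J = I ∧ β = α then 1 else 0) = w.2.2 I α := by
    simp [ite_and]
  rw [s] at hX
  simp at hX
  rw [pderivU]
  linarith

/-- A solution of the unified equations satisfies
`p^i_α = ∂L/∂u^α_i - ∑_j (1/n(ij)) ∂p^{1_i+1_j}_α/∂x^j`. -/
theorem mom_one_eq_of_unified {L : JetModel m n 2 → ℝ} {w : WrModel m n}
    (hL : DifferentiableAt ℝ L (truncate (by norm_num) w.1)) {u : Fin m → WrModel m n}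
    (hu : ∀ i, (u i).1.1 = Pi.single i 1)
    (h : ∀ X, omegaR L w (Matrix.vecCons X u) = 0) (i : Fin m) (α : Fin n) :
    w.2.1 i α = pderivU L (MIdx.one 1 i) α (truncate (by norm_num) w.1)
      - ∑ j, 1 / nn i j * (u j).2.2 (MIdx.two i j) α := by
  -- The contraction is with `∂/∂u^α_i`. It has no component along `u^α`, so the derivatives of the
  -- `p^i_α` drop out, while those of the second-order momenta remain with weight `1/n(ij)`.
  let v : JetModel m n 3 := vecu (MIdx.one 2 i) α
  have hX := h (v, 0)
  have e : (fun b => hamiltonTangent L w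
        ((Matrix.vecCons (v, 0) u : Fin (m + 1) → WrModel m n) b)) =
      Matrix.vecCons (hamiltonTangent L w (v, 0)) fun b => hamiltonTangent L w (u b) := by
    funext b
    refine Fin.cases rfl (fun _ => rfl) b
  have hv : truncate (show 1 ≤ 3 by norm_num) v = (vecu (MIdx.one 0 i) α : JetModel m n 1) :=
    truncate_vecu_of_le (show 1 ≤ 3 by norm_num) (MIdx.one 0 i) α
  have hv₂ : truncate (show 2 ≤ 3 by norm_num) v = (vecu (MIdx.one 1 i) α : JetModel m n 2) :=
    truncate_vecu_of_le (show 2 ≤ 3 by norm_num) (MIdx.one 1 i) α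
  have hinj : ∀ (k : ℕ) (a b : Fin m), MIdx.one k a = MIdx.one k b ↔ a = b := by
    intro k a b
    refine ⟨fun hab => ?_, fun hab => hab ▸ rfl⟩
    by_contra hne
    have := congrFun (congrArg Subtype.val hab) a
    simp [MIdx.one, hne] at this
  have hzero : ∀ j : Fin m, MIdx.zero 1 ≠ MIdx.one 0 j := by
    intro j hj
    have := congrFun (congrArg Subtype.val hj) j
    simp [MIdx.zero, MIdx.one] at this
  have htwo : ∀ I : MIdxTwo m, (⟨I.1.1, I.1.2.trans (by norm_num)⟩ : MIdx m 3) ≠ MIdx.one 2 i := by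
    intro I hi
    have := I.2
    rw [congrArg Subtype.val hi] at this
    simp [MIdx.one] at this
  have hY : (hamiltonTangent L w (v, 0)).1.1 = 0 := rfl
  rw [omegaR_apply hL, e, liouvilleOmega_vertical _ _ hY _ hu rfl] at hX
  simp only [hamiltonTangent, hv, fderiv_hamiltonian_apply hL, hv₂] at hX
  simp only [v, vecu_snd_apply, hinj, hzero, htwo] at hX
  simp [ite_and] at hX
  rw [pderivU]
  simp only [one_div]
  linarith

end FieldEquations

end SecondOrderField

namespace SecondOrderField

/-! ### Holonomic solutions and the graph of the Legendre map -/

section HolonomicSolutions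

variable {m n : ℕ} {L : JetModel m n 2 → ℝ} {O : Set (Base m)} {s : Base m → Fibre n}
  {Ψ : Base m → WrModel m n}

/-- Holonomy: the derivatives of the `2`-jet coordinates of a section are those of its `3`-jet. -/
theorem hasFDerivAt_truncate_of_holonomic (hO : IsOpen O) (hs : ContDiffOn ℝ ∞ s O)
    {q : Base m → JetModel m n 3} {y : Base m} (hd : DifferentiableAt ℝ q y) (hy : y ∈ O)
    (hq : ∀ y ∈ O, q y = (y, fun I => partialDeriv I.1 s y)) (j : Fin m) :
    truncate (Nat.le_succ 2) (fderiv ℝ q y (Pi.single j 1)) =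
      holonomicLift (q y) (Pi.single j 1) := by
  have hO' := hO.mem_nhds hy
  have h₁ : HasFDerivAt (fun y => (q y).1) _ y := hd.hasFDerivAt.fst
  have h₁' : HasFDerivAt (fun y => (q y).1) (ContinuousLinearMap.id ℝ (Base m)) y :=
    (hasFDerivAt_id y).congr_of_eventuallyEq
      (Filter.eventuallyEq_of_mem hO' fun z hz => by rw [hq z hz]; rfl)
  refine Prod.ext ?_ (funext fun I => ?_)
  · exact congrArg (fun f : Base m →L[ℝ] Base m => f (Pi.single j 1)) (h₁.unique h₁')
  · rw [holonomicLift_single, hq y hy]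
    let I' : MIdx m 3 := ⟨I.1, I.2.trans (Nat.le_succ 2)⟩
    have h₂ : HasFDerivAt (fun y => (q y).2 I') _ y :=
      (ContinuousLinearMap.proj (R := ℝ) (φ := fun _ : MIdx m 3 => Fibre n) I').hasFDerivAt.comp y
        hd.hasFDerivAt.snd
    have h₃ : (fun y => (q y).2 I') =ᶠ[𝓝 y] partialDeriv I.1 s :=
      Filter.eventuallyEq_of_mem hO' fun z hz => by simp only [hq z hz]; rfl
    -- Differentiating the coordinate `u^α_I` of a prolongation gives `u^α_{I+1_j}`, still a
    -- coordinate of the `3`-jet since `|I| ≤ 2`.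
    have h₄ := pderiv_partialDeriv hO I.1 j hs hy
    rw [pderiv, ← h₃.fderiv_eq, h₂.fderiv] at h₄
    exact h₄

/-- Holonomic solutions of the unified equations take values in the graph of the restricted
Legendre map. -/
theorem mom_eq_legendreMom_of_unified (hO : IsOpen O) (hs : ContDiffOn ℝ ∞ s O)
    (hΨ : ∀ y ∈ O, DifferentiableAt ℝ Ψ y)
    (hq : ∀ y ∈ O, (Ψ y).1 = (y, fun I => partialDeriv I.1 s y))
    (hL : ∀ y ∈ O, ContDiffAt ℝ ∞ L (truncate (by norm_num) (Ψ y).1))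
    (h : ∀ y ∈ O, ∀ X, omegaR L (Ψ y)
      (Matrix.vecCons X fun i => fderiv ℝ Ψ y (Pi.single i 1)) = 0) :
    ∀ y ∈ O, (Ψ y).2 = legendreMom L (Ψ y).1 := by
  have hL' : ∀ y ∈ O, DifferentiableAt ℝ L (truncate (by norm_num) (Ψ y).1) :=
    fun y hy => (hL y hy).differentiableAt (by simp)
  have hd : ∀ y ∈ O, DifferentiableAt ℝ (fun y => (Ψ y).1) y := fun y hy => (hΨ y hy).fst
  have hlift : ∀ y ∈ O, ∀ j, truncate (Nat.le_succ 2) (fderiv ℝ Ψ y (Pi.single j 1)).1 =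
      holonomicLift (Ψ y).1 (Pi.single j 1) := by
    intro y hy j
    have := hasFDerivAt_truncate_of_holonomic hO hs (hd y hy) hy hq j
    rwa [show fderiv ℝ (fun y => (Ψ y).1) y = _ from (hΨ y hy).hasFDerivAt.fst.fderiv] at this
  have hframe : ∀ y ∈ O, ∀ i, (fderiv ℝ Ψ y (Pi.single i 1)).1.1 = Pi.single i 1 :=
    fun y hy i => congrArg Prod.fst (hlift y hy i)
  have htwo : ∀ y ∈ O, ∀ I α, (Ψ y).2.2 I α =
      pderivU L I.1 α (truncate (by norm_num) (Ψ y).1) :=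
    fun y hy => mom_two_eq_of_unified (hL' y hy) (hframe y hy) (h y hy)
  -- The relation `htwo` holds throughout the open set `O`, so both sides have the same derivative.
  -- By `hlift` the chain rule on the right produces the total derivative.
  have hderiv : ∀ y ∈ O, ∀ (j : Fin m) I α, (fderiv ℝ Ψ y (Pi.single j 1)).2.2 I α =
      totalDeriv j (pderivU L I.1 α) (Ψ y).1 := by
    intro y hy j I α
    have h₁ : HasFDerivAt (fun y => (Ψ y).2.2 I α) _ y :=
      ((ContinuousLinearMap.proj (R := ℝ) (φ := fun _ : Fin n => ℝ) α).comp
        (ContinuousLinearMap.proj (R := ℝ) (φ := fun _ : MIdxTwo m => Fibre n) I)).hasFDerivAt.comp y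
          (hΨ y hy).hasFDerivAt.snd.snd
    have h₂ := ((contDiffAt_pderivU (hL y hy) I.1 α).differentiableAt (by simp)).hasFDerivAt.comp y
      ((truncateCLM (Nat.le_succ 2)).hasFDerivAt.comp y (hΨ y hy).hasFDerivAt.fst)
    have h₃ := h₁.unique (h₂.congr_of_eventuallyEq
      (Filter.eventuallyEq_of_mem (hO.mem_nhds hy) fun z hz => htwo z hz I α))
    have h₄ := congrArg (fun f : Base m →L[ℝ] ℝ => f (Pi.single j 1)) h₃
    refine h₄.trans ?_
    rw [totalDeriv, ← hlift y hy j]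
    rfl
  intro y hy
  refine Prod.ext (funext fun i => funext fun α => ?_) (funext fun I => funext fun α => htwo y hy I α)
  rw [mom_one_eq_of_unified (hL' y hy) (hframe y hy) (h y hy) i α]
  simp only [hderiv y hy]
  rfl

/-- On sections with values in the graph of the restricted Legendre map, the Poincaré–Cartan form
is the restriction of the unified form. -/
theorem omegaL_eq_omegaR {y : Base m} (hΨ : DifferentiableAt ℝ Ψ y)
    (hL : ContDiffAt ℝ ∞ L (truncate (by norm_num) (Ψ y).1))
    (hleg : (fun y => (Ψ y).2) =ᶠ[𝓝 y] fun y => legendreMom L (Ψ y).1)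
    (X : JetModel m n 3) (v : Fin m → Base m) :
    omegaL L (Ψ y).1 (Matrix.vecCons X fun i => fderiv ℝ (fun y => (Ψ y).1) y (v i)) =
      omegaR L (Ψ y) (Matrix.vecCons (X, fderiv ℝ (legendreMom L) (Ψ y).1 X)
        fun i => fderiv ℝ Ψ y (v i)) := by
  have h₁ : fderiv ℝ (fun y => (Ψ y).1) y = _ := hΨ.hasFDerivAt.fst.fderiv
  have h₂ : fderiv ℝ (fun y => (Ψ y).2) y = _ := hΨ.hasFDerivAt.snd.fderiv
  have h₃ := ((contDiffAt_legendreMom hL).differentiableAt (by simp)).hasFDerivAt.comp y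
    hΨ.hasFDerivAt.fst
  have h₄ : fderiv ℝ (fun y => legendreMom L (Ψ y).1) y = _ := h₃.fderiv
  -- Equality with the Legendre momenta near `y`, not just at `y`, makes the tangent vectors of `Ψ`
  -- tangent to the graph.
  rw [hleg.fderiv_eq, h₄] at h₂
  have hy : ((Ψ y).1, legendreMom L (Ψ y).1) = Ψ y := Prod.ext rfl hleg.self_of_nhds.symm
  rw [omegaL_apply hL, omegaR_apply (hL.differentiableAt (by simp)), hy]
  congr 1
  funext b
  refine Fin.cases rfl (fun i => ?_) b
  simp only [Matrix.cons_val_succ, h₁]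
  congr 1
  exact Prod.ext rfl (congrArg (fun f : Base m →L[ℝ] RMom m n => f (v i)) h₂)

end HolonomicSolutions

/-! ### Sections in adapted charts -/

section Charts

variable {m n : ℕ} {M E : Type*}
  [TopologicalSpace M] [ChartedSpace (Base m) M]
  [TopologicalSpace E] [ChartedSpace (Base m × Fibre n) E]
  {B : ConfigBundle m n M E}

namespace AdaptedChart

theorem isOpen_jetTarget (c : AdaptedChart B) (k : ℕ) : IsOpen (c.jetTarget k) :=
  c.tot.open_target.preimage (by fun_prop :
    Continuous fun q : JetModel m n k => (q.1, q.2 (MIdx.zero k)))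

theorem fst_mem_base_target (c : AdaptedChart B) {k : ℕ} {q : JetModel m n k}
    (hq : q ∈ c.jetTarget k) : q.1 ∈ c.base.target := by
  have h := c.tot.map_target hq
  have h' := c.proj_eq _ h
  rw [c.tot.right_inv hq] at h'
  rw [← h']
  exact c.base.map_source (c.proj_mem _ h)

/-- Both factors are smooth only on chart images, which are open; outside the image `jetRep` takes
the default value `0`. -/
theorem contDiffAt_lagrangian (c : AdaptedChart B) (η : VolumeForm m M) {L : Jet B 2 → ℝ}
    (hL : IsSmoothOnJets L) {q : JetModel m n 2} (hq : q ∈ c.jetTarget 2) :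
    ContDiffAt ℝ ∞ (c.lagrangian η L) q :=
  (((η.smooth c.base c.base_mem).contDiffAt
    (c.base.open_target.mem_nhds (c.fst_mem_base_target hq))).comp q contDiffAt_fst).mul
    ((hL c).contDiffAt ((c.isOpen_jetTarget 2).mem_nhds hq))

/-- Openness allows identities along a section to be differentiated. -/
theorem isOpen_sectionDomain (c : AdaptedChart B) {U : Set M} (hU : IsOpen U) {σ : M → E}
    (hσ : ContinuousOn σ U) : IsOpen (c.sectionDomain U σ) :=
  c.base.symm.isOpen_inter_preimage (hσ.isOpen_inter_preimage hU c.tot.open_source)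

theorem contDiffAt_sectionRep [IsManifold 𝓘(ℝ, Base m) ∞ M]
    [IsManifold 𝓘(ℝ, Base m × Fibre n) ∞ E] (c : AdaptedChart B) {σ : M → E} {y : Base m}
    (hy : y ∈ c.base.target) (hσ : σ (c.base.symm y) ∈ c.tot.source)
    (hσ' : ContMDiffAt 𝓘(ℝ, Base m) 𝓘(ℝ, Base m × Fibre n) ∞ σ (c.base.symm y)) :
    ContDiffAt ℝ ∞ (c.sectionRep σ) y := by
  have h := (contMDiffAt_of_mem_maximalAtlas c.tot_mem hσ).comp y
    (hσ'.comp y (contMDiffAt_symm_of_mem_maximalAtlas c.base_mem hy))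
  exact (contMDiffAt_iff_contDiffAt.1 h).snd

end AdaptedChart

theorem IsHolonomic.contDiffOn_sectionRep [IsManifold 𝓘(ℝ, Base m) ∞ M]
    [IsManifold 𝓘(ℝ, Base m × Fibre n) ∞ E] {U : Set M} {ψ : M → Jet B 3}
    (hol : IsHolonomic U ψ) (c : AdaptedChart B) :
    ContDiffOn ℝ ∞ (c.sectionRep fun x => (ψ x).value)
      (c.sectionDomain U fun x => (ψ x).value) := fun y hy => by
  obtain ⟨h, -⟩ := hol _ hy.2.1
  exact (c.contDiffAt_sectionRep hy.1 hy.2.2 h.self_of_nhds.2).contDiffWithinAt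

theorem IsHolonomic.jetCoord_eq {U : Set M} {ψ : M → Jet B 3} (hol : IsHolonomic U ψ)
    (c : AdaptedChart B) {y : Base m} (hy : y ∈ c.sectionDomain U fun x => (ψ x).value) :
    c.jetCoord (ψ (c.base.symm y)) =
      (y, fun I : MIdx m 3 => partialDeriv I.1 (c.sectionRep fun x => (ψ x).value) y) := by
  obtain ⟨h, h'⟩ := hol _ hy.2.1
  rw [h', c.jetCoord_mk _ _ h hy.2.2, c.base.right_inv hy.1]

theorem IsHolonomic.jetCoord_mem {U : Set M} {ψ : M → Jet B 3} (hol : IsHolonomic U ψ)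
    (c : AdaptedChart B) {y : Base m} (hy : y ∈ c.sectionDomain U fun x => (ψ x).value) :
    c.jetCoord (ψ (c.base.symm y)) ∈ c.jetTarget 3 := by
  obtain ⟨h, -⟩ := hol _ hy.2.1
  have h₁ := c.proj_eq _ hy.2.2
  rw [h.self_of_nhds.1, c.base.right_inv hy.1] at h₁
  -- For the multi-index `0` the list of derivatives is empty, so the coordinate is the fibre
  -- component of the section itself.
  have h₂ : partialDeriv (0 : Fin m → ℕ) (c.sectionRep fun x => (ψ x).value) y =
      (c.tot (ψ (c.base.symm y)).value).2 := by
    rw [partialDeriv, List.flatMap_eq_nil_iff.2 (by simp)]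
    rfl
  rw [hol.jetCoord_eq c hy]
  change (y, partialDeriv (0 : Fin m → ℕ) _ y) ∈ c.tot.target
  rw [h₂, show (y, (c.tot (ψ (c.base.symm y)).value).2) = c.tot (ψ (c.base.symm y)).value from
    Prod.ext h₁ rfl]
  exact c.tot.map_source hy.2.2

end Charts

end SecondOrderField

/-! ### The proposition, chart by chart -/

theorem mainTheorem5 {m n : ℕ} {M E : Type*}
    [TopologicalSpace M] [T2Space M] [SecondCountableTopology M]
    [ChartedSpace (SecondOrderField.Base m) M]
    [IsManifold 𝓘(ℝ, SecondOrderField.Base m) ∞ M]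
    [TopologicalSpace E] [T2Space E] [SecondCountableTopology E]
    [ChartedSpace (SecondOrderField.Base m × SecondOrderField.Fibre n) E]
    [IsManifold 𝓘(ℝ, SecondOrderField.Base m × SecondOrderField.Fibre n) ∞ E]
    (B : SecondOrderField.ConfigBundle m n M E)
    (η : SecondOrderField.VolumeForm m M)
    (L : SecondOrderField.Jet B 2 → ℝ) (hL : SecondOrderField.IsSmoothOnJets L)
    (U : Set M) (hU : IsOpen U)
    (ψ : M → SecondOrderField.Wr B)
    (hψ : SecondOrderField.IsWrSection U ψ)
    (hol : SecondOrderField.IsWrHolonomic U ψ)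
    (heq : SecondOrderField.SolvesUnified η L U ψ) :
    SecondOrderField.IsJetSection U (fun x => (ψ x).jet) ∧
      SecondOrderField.IsHolonomic U (fun x => (ψ x).jet) ∧
      SecondOrderField.SolvesLagrangian η L U (fun x => (ψ x).jet) := by
  refine ⟨⟨hψ.1, hψ.2.1, fun c => (hψ.2.2 c).fst⟩, hol, fun c X _ y hy => ?_⟩
  have hO := c.isOpen_sectionDomain hU hψ.2.1
  have hd : ∀ z ∈ c.sectionDomain U (fun x => (ψ x).jet.value),
      DifferentiableAt ℝ (fun y => c.wrCoord (ψ (c.base.symm y))) z :=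
    fun z hz => ((hψ.2.2 c).differentiableOn (by simp)).differentiableAt (hO.mem_nhds hz)
  -- Membership in `jetTarget` only concerns `(x^i, u^α)`, so the statement for the `3`-jet serves
  -- for its `2`-jet.
  have hLc : ∀ z ∈ c.sectionDomain U (fun x => (ψ x).jet.value),
      ContDiffAt ℝ ∞ (c.lagrangian η L)
        (SecondOrderField.truncate (by norm_num) (c.wrCoord (ψ (c.base.symm z))).1) :=
    fun z hz => c.contDiffAt_lagrangian η hL (hol.jetCoord_mem c hz)
  -- Constant vector fields already give the equation for every tangent vector at every point.
  have hunif : ∀ z ∈ c.sectionDomain U (fun x => (ψ x).jet.value),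
      ∀ Y (v : Fin m → SecondOrderField.Base m), SecondOrderField.omegaR (c.lagrangian η L)
        (c.wrCoord (ψ (c.base.symm z))) (Matrix.vecCons Y fun i =>
          fderiv ℝ (fun y => c.wrCoord (ψ (c.base.symm y))) z (v i)) = 0 :=
    fun z hz Y v => congrArg (fun ζ => ζ v) (heq c (fun _ => Y) contDiffOn_const z hz)
  have hleg := SecondOrderField.mom_eq_legendreMom_of_unified hO (hol.contDiffOn_sectionRep c) hd
    (fun z hz => hol.jetCoord_eq c hz) hLc fun z hz Y => hunif z hz Y _
  ext v
  exact (SecondOrderField.omegaL_eq_omegaR (hd y hy) (hLc y hy)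
    (Filter.eventuallyEq_of_mem (hO.mem_nhds hy) hleg) _ v).trans (hunif y hy _ v)
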